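/- Let $A\in\mathbb{C}^{m\times n}$ with $\operatorname{rank}(A)<n$, let $\mathbf{b}\in\operatorname{Range}(A)\subset\mathbb{C}^m$, and let $A^\dagger$ denote the Moore--Penrose inverse of $A$; $\|\cdot\|_2$ is the Euclidean norm of vectors and the spectral norm of matrices. Let $\tilde A\in\mathbb{C}^{m\times n}$, $\tilde{\mathbf{b}}\in\mathbb{C}^m$ and $\tilde{\mathbf{x}}\in\mathbb{C}^n$ satisfy $\tilde A\tilde{\mathbf{x}}=\tilde{\mathbf{b}}$ and $$\|\tilde A-A\|_2\le 0.46\,\|A^\dagger\|_2^{-1},$$ and put $\Delta A=A-\tilde A$, $\Delta\mathbf{b}=\mathbf{b}-\tilde{\mathbf{b}}$. Then there is an exact solution $\mathbf{x}_*\in\mathbb{C}^n$ of $A\mathbf{x}=\mathbf{b}$ such that, if $\mathbf{b}\ne\mathbf{0}$, $$\frac{\|\tilde{\mathbf{x}}-\mathbf{x}_*\|_2}{\|\mathbf{x}_*\|_2}\le\frac{\|A\|_2\|A^\dagger\|_2}{1-\|A^\dagger\|_2\|\Delta A\|_2}\left(2\sqrt2\,\frac{\|\Delta A\|_2}{\|A\|_2}+\frac{\|\Delta\mathbf{b}\|_2}{\|\mathbf{b}\|_2}\right),$$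 and, if $\mathbf{b}=\mathbf{0}$, $$\|\tilde{\mathbf{x}}-\mathbf{x}_*\|_2\le\frac{\|A\|_2\|A^\dagger\|_2}{1-\|A^\dagger\|_2\|\Delta A\|_2}\left(\|\tilde{\mathbf{x}}\|_2\,\frac{\|\Delta A\|_2}{\|A\|_2}+\frac{\|\Delta\mathbf{b}\|_2}{\|A\|_2}\right).$$ (In the degenerate case $A=0$, quotients by $0$ are read as $0$.) -/

import Mathlib

open scoped Matrix Matrix.Norms.L2Operator

namespace Matrix

/-- The four Moore-Penrose conditions: `X` is a Moore-Penrose inverse of `A`. -/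
structure IsMoorePenroseInverse {m n : ℕ} (A : Matrix (Fin m) (Fin n) ℂ)
    (X : Matrix (Fin n) (Fin m) ℂ) : Prop where
  mul_mul_self : A * X * A = A
  self_mul_mul : X * A * X = X
  left_hermitian : (A * X)ᴴ = A * X
  right_hermitian : (X * A)ᴴ = X * A

open scoped ComplexOrder in
theorem exists_isMoorePenroseInverse {m n : ℕ} (A : Matrix (Fin m) (Fin n) ℂ) :
    ∃ X, IsMoorePenroseInverse A X := by
  -- a Hermitian matrix that inverts `Aᴴ * A` on its range and commutes with it
  obtain ⟨G, hG, h1, h2, h3⟩ : ∃ G : Matrix (Fin n) (Fin n) ℂ, Gᴴ = G ∧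
      (Aᴴ * A) * G * (Aᴴ * A) = Aᴴ * A ∧ G * (Aᴴ * A) * G = G ∧
      G * (Aᴴ * A) = (Aᴴ * A) * G := by
    have hH : (Aᴴ * A).IsHermitian := isHermitian_conjTranspose_mul_self A
    set d : Fin n → ℂ := fun i => (hH.eigenvalues i : ℂ) with hd
    set e : Fin n → ℂ := fun i => ((hH.eigenvalues i)⁻¹ : ℝ) with he
    set U : Matrix (Fin n) (Fin n) ℂ := hH.eigenvectorUnitary.1 with hU
    have hUU : Uᴴ * U = 1 := by
      rw [← star_eq_conjTranspose]
      exact Unitary.coe_star_mul_self hH.eigenvectorUnitary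
    have hspec : Aᴴ * A = U * diagonal d * Uᴴ := by
      have := hH.spectral_theorem
      rw [Unitary.conjStarAlgAut_apply] at this
      exact this
    have key : ∀ X Y : Matrix (Fin n) (Fin n) ℂ,
        (U * X * Uᴴ) * (U * Y * Uᴴ) = U * (X * Y) * Uᴴ := by
      intro X Y
      calc (U * X * Uᴴ) * (U * Y * Uᴴ) = U * X * (Uᴴ * U) * Y * Uᴴ := by
            simp only [Matrix.mul_assoc]
        _ = U * (X * Y) * Uᴴ := by rw [hUU]; simp only [Matrix.mul_assoc, Matrix.mul_one]
    refine ⟨U * diagonal e * Uᴴ, ?_, ?_, ?_, ?_⟩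
    · have : star e = e := by
        funext i
        simp [he]
      simp [conjTranspose_mul, diagonal_conjTranspose, this, Matrix.mul_assoc]
    · rw [hspec, key, key, diagonal_mul_diagonal, diagonal_mul_diagonal]
      congr 3
      funext i
      by_cases h : hH.eigenvalues i = 0 <;> simp [hd, he, h]
    · rw [hspec, key, key, diagonal_mul_diagonal, diagonal_mul_diagonal]
      congr 3
      funext i
      by_cases h : hH.eigenvalues i = 0 <;> simp [hd, he, h]
    · rw [hspec, key, key, diagonal_mul_diagonal, diagonal_mul_diagonal]
      congr 3
      funext i
      exact mul_comm _ _
  refine ⟨G * Aᴴ, ?_, ?_, ?_, ?_⟩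
  · have h0 : (A * (G * (Aᴴ * A) - 1))ᴴ * (A * (G * (Aᴴ * A) - 1)) = 0 := by
      have : Aᴴ * (A * (G * (Aᴴ * A) - 1)) = 0 := by
        rw [← Matrix.mul_assoc, Matrix.mul_sub, Matrix.mul_one, ← Matrix.mul_assoc, h1, sub_self]
      rw [conjTranspose_mul, Matrix.mul_assoc, this, Matrix.mul_zero]
    have h5 := conjTranspose_mul_self_eq_zero.mp h0
    rw [Matrix.mul_sub, Matrix.mul_one, sub_eq_zero] at h5
    simpa only [Matrix.mul_assoc] using h5
  · calc G * Aᴴ * A * (G * Aᴴ) = (G * (Aᴴ * A) * G) * Aᴴ := by simp only [Matrix.mul_assoc]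
      _ = G * Aᴴ := by rw [h2]
  · simp [conjTranspose_mul, hG, Matrix.mul_assoc]
  · rw [Matrix.mul_assoc, conjTranspose_mul, hG, conjTranspose_mul, conjTranspose_conjTranspose, h3]

/-- A Moore-Penrose inverse is unique. -/
theorem IsMoorePenroseInverse.unique {m n : ℕ} {A : Matrix (Fin m) (Fin n) ℂ}
    {X Y : Matrix (Fin n) (Fin m) ℂ} (hX : IsMoorePenroseInverse A X)
    (hY : IsMoorePenroseInverse A Y) : X = Y := by
  have hA : A * X = A * Y := by
    calc A * X = (A * X)ᴴ := hX.left_hermitian.symm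
      _ = (A * Y * A * X)ᴴ := by rw [hY.mul_mul_self]
      _ = (A * X)ᴴ * (A * Y)ᴴ := by rw [← conjTranspose_mul]; simp only [Matrix.mul_assoc]
      _ = A * X * A * Y := by
        rw [hX.left_hermitian, hY.left_hermitian]; simp only [Matrix.mul_assoc]
      _ = A * Y := by rw [hX.mul_mul_self]
  have hB : X * A = Y * A := by
    calc X * A = (X * A)ᴴ := hX.right_hermitian.symm
      _ = (X * (A * Y * A))ᴴ := by rw [hY.mul_mul_self]
      _ = (Y * A)ᴴ * (X * A)ᴴ := by rw [← conjTranspose_mul]; simp only [Matrix.mul_assoc]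
      _ = Y * (A * X * A) := by
        rw [hX.right_hermitian, hY.right_hermitian]; simp only [Matrix.mul_assoc]
      _ = Y * A := by rw [hX.mul_mul_self]
  calc X = X * A * X := hX.self_mul_mul.symm
    _ = Y * A * Y := by rw [hB, Matrix.mul_assoc, hA, Matrix.mul_assoc]
    _ = Y := hY.self_mul_mul

/-- The Moore-Penrose inverse `A†` of `A`: the unique matrix satisfying the Moore-Penrose
conditions. -/
noncomputable def moorePenrose {m n : ℕ} (A : Matrix (Fin m) (Fin n) ℂ) :
    Matrix (Fin n) (Fin m) ℂ :=
  Classical.choose (exists_isMoorePenroseInverse A)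

theorem isMoorePenroseInverse_moorePenrose {m n : ℕ} (A : Matrix (Fin m) (Fin n) ℂ) :
    IsMoorePenroseInverse A A.moorePenrose :=
  Classical.choose_spec (exists_isMoorePenroseInverse A)

/-- The set of all vector solutions of `A x = b`. -/
def sol {m n : ℕ} (A : Matrix (Fin m) (Fin n) ℂ) (b : EuclideanSpace ℂ (Fin m)) :
    Set (EuclideanSpace ℂ (Fin n)) :=
  {u | A.toEuclideanLin u = b}

end Matrix

namespace Matrix

/-! The witness is `x = x' - A†(A x' - b)`, a solution because `A A†` fixes the range of `A`. Since
`A' x' = b'`, the residual is `ΔA x' - Δb`, so `‖x' - x‖ ≤ ‖A†‖ (‖ΔA‖ ‖x'‖ + ‖Δb‖)`. For `b ≠ 0`,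
bounding `‖x'‖` by `‖x' - x‖ + ‖x‖` and absorbing the first term produces the denominator `1 - ‖A†‖
‖ΔA‖`; then `‖b‖ ≤ ‖A‖ ‖x‖` makes the estimate relative. No comparison of `A†` with the inverse of
`A'` is involved. -/

theorem norm_toEuclideanLin_apply_le {m n : ℕ} (A : Matrix (Fin m) (Fin n) ℂ)
    (x : EuclideanSpace ℂ (Fin n)) : ‖A.toEuclideanLin x‖ ≤ ‖A‖ * ‖x‖ :=
  l2_opNorm_mulVec A x

theorem toEuclideanLin_mul_apply {l m n : ℕ} (A : Matrix (Fin l) (Fin m) ℂ)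
    (B : Matrix (Fin m) (Fin n) ℂ) (x : EuclideanSpace ℂ (Fin n)) :
    (A * B).toEuclideanLin x = A.toEuclideanLin (B.toEuclideanLin x) := by
  simp [toEuclideanLin, toLpLin_apply, mulVec_mulVec]

/-- Subtracting `A† (A y - b)` from `y` yields a solution of the consistent system `A x = b`. -/
theorem sub_moorePenrose_residual_mem_sol {m n : ℕ} (A : Matrix (Fin m) (Fin n) ℂ)
    {b : EuclideanSpace ℂ (Fin m)} (hb : b ∈ LinearMap.range A.toEuclideanLin)
    (y : EuclideanSpace ℂ (Fin n)) :
    y - A.moorePenrose.toEuclideanLin (A.toEuclideanLin y - b) ∈ A.sol b := by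
  obtain ⟨u, rfl⟩ := hb
  have h (z : EuclideanSpace ℂ (Fin n)) :
      A.toEuclideanLin (A.moorePenrose.toEuclideanLin (A.toEuclideanLin z)) =
        A.toEuclideanLin z := by
    rw [← toEuclideanLin_mul_apply, ← toEuclideanLin_mul_apply,
      (isMoorePenroseInverse_moorePenrose A).mul_mul_self]
  change A.toEuclideanLin _ = _
  rw [← map_sub, map_sub, h, map_sub, sub_sub_cancel]

/-- If `A' y = b'`, the residual of `y` in `A x = b` is controlled by the perturbations. -/
theorem norm_residual_le {m n : ℕ} (A : Matrix (Fin m) (Fin n) ℂ)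
    {A' : Matrix (Fin m) (Fin n) ℂ} (b : EuclideanSpace ℂ (Fin m))
    {b' : EuclideanSpace ℂ (Fin m)} {y : EuclideanSpace ℂ (Fin n)} (hy : y ∈ A'.sol b') :
    ‖A.toEuclideanLin y - b‖ ≤ ‖A - A'‖ * ‖y‖ + ‖b - b'‖ := by
  have h : A.toEuclideanLin y - b = (A - A').toEuclideanLin y - (b - b') := by
    rw [map_sub, LinearMap.sub_apply, show A'.toEuclideanLin y = b' from hy]
    abel
  rw [h]
  exact (norm_sub_le _ _).trans (by gcongr; exact norm_toEuclideanLin_apply_le _ _)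

end Matrix

theorem theorem4 {m n : ℕ} (A A' : Matrix (Fin m) (Fin n) ℂ)
    (b b' : EuclideanSpace ℂ (Fin m)) (x' : EuclideanSpace ℂ (Fin n))
    (hrank : A.rank < n)
    (hb : b ∈ LinearMap.range A.toEuclideanLin)
    (hx' : x' ∈ A'.sol b')
    (hA' : ‖A' - A‖ ≤ 0.46 * ‖A.moorePenrose‖⁻¹) :
    ∃ x ∈ A.sol b,
      (b ≠ 0 →
        ‖x' - x‖ / ‖x‖ ≤
          ‖A‖ * ‖A.moorePenrose‖ / (1 - ‖A.moorePenrose‖ * ‖A - A'‖) *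
            (2 * √2 * (‖A - A'‖ / ‖A‖) + ‖b - b'‖ / ‖b‖)) ∧
      (b = 0 →
        ‖x' - x‖ ≤
          ‖A‖ * ‖A.moorePenrose‖ / (1 - ‖A.moorePenrose‖ * ‖A - A'‖) *
            (‖x'‖ * (‖A - A'‖ / ‖A‖) + ‖b - b'‖ / ‖A‖)) := by
  have hsol := Matrix.sub_moorePenrose_residual_mem_sol A hb x'
  set x := x' - A.moorePenrose.toEuclideanLin (A.toEuclideanLin x' - b) with hx
  have hdist : ‖x' - x‖ ≤ ‖A.moorePenrose‖ * (‖A - A'‖ * ‖x'‖ + ‖b - b'‖) := by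
    rw [hx, sub_sub_cancel]
    exact (Matrix.norm_toEuclideanLin_apply_le _ _).trans
      (by gcongr; exact Matrix.norm_residual_le A b hx')
  have hε : ‖A.moorePenrose‖ * ‖A - A'‖ ≤ 0.46 := by
    rw [norm_sub_rev]
    calc ‖A.moorePenrose‖ * ‖A' - A‖
        ≤ ‖A.moorePenrose‖ * (0.46 * ‖A.moorePenrose‖⁻¹) := by gcongr
      _ = 0.46 * (‖A.moorePenrose‖ * ‖A.moorePenrose‖⁻¹) := by ring
      -- An inequality, not an equality: the product is `0` when `A† = 0`.
      _ ≤ 0.46 * 1 := by gcongr; exact mul_inv_le_one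
      _ = 0.46 := mul_one _
  have hε0 : 0 ≤ ‖A.moorePenrose‖ * ‖A - A'‖ := by positivity
  have hden : 0 < 1 - ‖A.moorePenrose‖ * ‖A - A'‖ := by linarith
  refine ⟨x, hsol, fun hb0 => ?_, fun hb0 => ?_⟩
  · have hbx : ‖b‖ ≤ ‖A‖ * ‖x‖ := by
      rw [← show A.toEuclideanLin x = b from hsol]
      exact Matrix.norm_toEuclideanLin_apply_le _ _
    have hbpos : 0 < ‖b‖ := norm_pos_iff.mpr hb0
    have hApos : 0 < ‖A‖ := by
      by_contra h
      nlinarith [norm_nonneg x]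
    have hxpos : 0 < ‖x‖ := by
      by_contra h
      nlinarith
    have htri : ‖x'‖ ≤ ‖x' - x‖ + ‖x‖ := by
      simpa using norm_add_le (x' - x) x
    -- Absorption: the multiple of `‖x' - x‖` on the right of `hdist` moves to the left.
    have habs : (1 - ‖A.moorePenrose‖ * ‖A - A'‖) * ‖x' - x‖ ≤
        ‖A.moorePenrose‖ * (‖A - A'‖ * ‖x‖ + ‖b - b'‖) := by
      linarith [mul_le_mul_of_nonneg_left htri hε0]
    -- The argument yields the constant `1`; `2√2` only weakens it.
    have hsqrt : 1 ≤ 2 * √2 := by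
      linarith [Real.one_le_sqrt.mpr (one_le_two : (1 : ℝ) ≤ 2)]
    calc ‖x' - x‖ / ‖x‖
        ≤ ‖A.moorePenrose‖ * (‖A - A'‖ * ‖x‖ + ‖b - b'‖) /
            (1 - ‖A.moorePenrose‖ * ‖A - A'‖) / ‖x‖ := by
          gcongr
          rwa [le_div_iff₀' hden]
      _ = ‖A‖ * ‖A.moorePenrose‖ / (1 - ‖A.moorePenrose‖ * ‖A - A'‖) *
            (1 * (‖A - A'‖ / ‖A‖) + ‖b - b'‖ / (‖A‖ * ‖x‖)) := by
          field_simp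
      _ ≤ _ := by gcongr
  · rcases eq_or_ne A 0 with hA | hA
    -- If `A = 0` then `A† = 0`, so both sides vanish.
    · have hX : A.moorePenrose = 0 := by
        rw [← (Matrix.isMoorePenroseInverse_moorePenrose A).self_mul_mul]
        simp [hA]
      simpa [hX] using hdist
    · have hApos : 0 < ‖A‖ := norm_pos_iff.mpr hA
      calc ‖x' - x‖ ≤ ‖A.moorePenrose‖ * (‖A - A'‖ * ‖x'‖ + ‖b - b'‖) := hdist
        -- The bound keeps `‖x'‖`, so nothing is absorbed; dividing by a number in `(0, 1]` only
        -- enlarges it.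
        _ ≤ ‖A.moorePenrose‖ * (‖A - A'‖ * ‖x'‖ + ‖b - b'‖) /
              (1 - ‖A.moorePenrose‖ * ‖A - A'‖) :=
            le_div_self (by positivity) hden (by linarith)
        _ = _ := by field_simp
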